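/- Let $\chi$ be a probability distribution with finite support $A$, with mass function $P_\chi$ and Shannon entropy $H(\chi) = -\sum_{x \in A} P_\chi(x)\log_2 P_\chi(x)$. For $n \ge 1$ let $\mathcal D = \chi^n$ be the $n$-fold product distribution, with support $\mathcal K = A^n$, and let $\mathrm{GetKey}$ be any enumeration of $\mathcal K$ in order of decreasing probability, so that $\mathrm{GetKey}(i)$, $1 \le i \le |\mathcal K|$, is an $i$-th most likely key (ties broken arbitrarily). For $m \ge 1$ let $k_1,\dots,k_m$ be drawn independently from $\mathcal D$, and let $0 < c < 1$. The algorithm has oracle access to the functions $\mathbb 1_{k_j}$, where $\mathbb 1_{k}(x) = 1$ if and only if $x = k$. $\mathrm{AbortedKeyGuess}(\mathbb 1_k, t)$ tries $\mathrm{GetKey}(1), \mathrm{GetKey}(2), \dots$ in this order; it returns the key as soon as the oracle answers $1$, and returns $\bot$ if this has not happened within $t$ trials. $\mathrm{MultiKeyGuess}$ sets $t \leftarrow 1$ and then repeats the following: set $t \leftarrow 2t$, and for every $j \in \{1,\dots,m\}$ set $k_j' \leftarrow \mathrm{AbortedKeyGuess}(\mathbb 1_{k_j}, t)$; it stops and returns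 $(k_1',\dots,k_m')$ after the first round in which $k_j' \neq \bot$ for at least $cm$ indices $j$. It solves the instance if $k_j' = k_j$ for at least $cm$ indices $j$. Its cost is the total number of trials (one trial being one call of $\mathrm{GetKey}$ and one oracle query), and its amortized cost per key is the cost divided by $m$. 1. If $c < \frac12$, then there are constants $\kappa, C > 0$ and $d \in \mathbb N$, depending only on $\chi$ and $c$, such that for all $n, m \ge 1$ and every such $\mathrm{GetKey}$, with probability at least $1 - e^{-\kappa m}$ over the keys, $\mathrm{MultiKeyGuess}$ terminates and solves the instance with amortized cost per key at most $$C \cdot 2^{H(\chi) n} \cdot \bigl(1 + \log_2 2^{H(\chi) n}\bigr)^d = \widetilde{\mathcal O}\bigl(2^{H(\chi) n}\bigr).$$ 2. If $\frac12 \le c < 1$, then there are constants $\kappa, C > 0$, depending only on $\chi$ and $c$, such that for all $n, m \ge 1$ and every such $\mathrm{GetKey}$, with probability at least $1 - e^{-\kappa m}$ over the keys, $\mathrm{MultiKeyGuess}$ terminates and solves the instance with amortized cost per key at most $$2^{H(\chi) n + C\sqrt n} = 2^{H(\chi) n + \mathcal O(\sqrt n)}.$$ -/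

import Mathlib

namespace MultiKey

noncomputable section

/-- The Shannon entropy (in bits) `- ∑ P(x) log₂ P(x)` of a discrete distribution. -/
def shannonEntropy {A : Type*} (χ : PMF A) : ℝ :=
  - ∑' a, (χ a).toReal * Real.logb 2 (χ a).toReal

/-- The product distribution `χ^n`: `n` independent samples from `χ`. -/
def iid {A : Type*} (χ : PMF A) : (n : ℕ) → PMF (Fin n → A)
  | 0 => PMF.pure Fin.elim0
  | n + 1 => χ.bind fun a => (iid χ n).bind fun v => PMF.pure (Fin.cons a v : Fin (n + 1) → A)

/-- The mass function of `χ^n` is `x ↦ ∏ i, P_χ(x i)`. -/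
theorem iid_apply {A : Type*} (χ : PMF A) (n : ℕ) (x : Fin n → A) :
    iid χ n x = ∏ i, χ (x i) := by
  classical
  induction n with
  | zero =>
    have hx : x = Fin.elim0 := Subsingleton.elim _ _
    simp [iid, PMF.pure_apply, hx]
  | succ n ih =>
    have h (a : A) (v : Fin n → A) : x = Fin.cons a v ↔ a = x 0 ∧ v = Fin.tail x := by
      constructor
      · rintro rfl
        simp
      · rintro ⟨rfl, rfl⟩
        simp
    simp only [iid, PMF.bind_apply, PMF.pure_apply, h]
    rw [tsum_eq_single (x 0)]
    · rw [tsum_eq_single (Fin.tail x)]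
      · simp [ih, Fin.prod_univ_succ, Fin.tail]
      · intro v hv
        simp [hv]
    · intro a ha
      simp [ha]

/-- `getKey` enumerates the support of `D` (indices `1, …, |supp D|`) in order of decreasing
probability, ties being broken arbitrarily. Values at other indices are unconstrained. -/
structure IsGetKey {K : Type*} (D : PMF K) (getKey : ℕ → K) : Prop where
  bijOn : Set.BijOn getKey (Set.Icc 1 D.support.ncard) D.support
  antitoneOn : AntitoneOn (fun i => D (getKey i)) (Set.Icc 1 D.support.ncard)

open Classical in
/-- The oracle `1_k`: it answers `true` exactly on the key `k`. -/
def keyOracle {K : Type*} (k : K) : K → Bool := fun x => decide (x = k)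

/-- The loop of aborted key guessing: having already tried the first `i` keys, try at most `r`
more. Returns the key found (`none` stands for `⊥`) and the number of trials made; one trial is
one call of `getKey` together with one oracle query. -/
def abortedLoop {K : Type*} (getKey : ℕ → K) (oracle : K → Bool) : (r i : ℕ) → Option K × ℕ
  | 0, _ => (none, 0)
  | r + 1, i =>
    if oracle (getKey (i + 1)) then (some (getKey (i + 1)), 1)
    else
      ((abortedLoop getKey oracle r (i + 1)).1, (abortedLoop getKey oracle r (i + 1)).2 + 1)

/-- AbortedKeyGuess: try the keys `getKey 1, getKey 2, …` in this order until the key is found,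
and give up after `t` trials. Returns the result and the number of trials made. -/
def abortedKeyGuess {K : Type*} (getKey : ℕ → K) (oracle : K → Bool) (t : ℕ) : Option K × ℕ :=
  abortedLoop getKey oracle t 0

/-- The tuple computed by one pass over all `m` oracles with threshold `t`. -/
def passOutput {K : Type*} {m : ℕ} (getKey : ℕ → K) (oracle : Fin m → K → Bool) (t : ℕ) :
    Fin m → Option K :=
  fun j => (abortedKeyGuess getKey (oracle j) t).1

/-- The number of trials made in one pass over all `m` oracles with threshold `t`. -/
def passCost {K : Type*} {m : ℕ} (getKey : ℕ → K) (oracle : Fin m → K → Bool) (t : ℕ) : ℕ :=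
  ∑ j, (abortedKeyGuess getKey (oracle j) t).2

/-- The stopping condition: at least `c m` entries of the tuple are different from `⊥`. -/
def Enough {K : Type*} {m : ℕ} (c : ℝ) (out : Fin m → Option K) : Prop :=
  c * m ≤ ({j | out j ≠ none} : Set (Fin m)).ncard

/-- Big-step semantics of the loop
`repeat (t ← 2t; run one pass with threshold t) until (at least c m keys were found)`:
`MultiKeyLoop getKey oracle c t out T` says that, entered with the value `t`, the loop
terminates with output `out` after `T` trials in total. -/
inductive MultiKeyLoop {K : Type*} {m : ℕ} (getKey : ℕ → K) (oracle : Fin m → K → Bool) (c : ℝ) :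
    ℕ → (Fin m → Option K) → ℕ → Prop
  | finish (t : ℕ) (h : Enough c (passOutput getKey oracle (2 * t))) :
      MultiKeyLoop getKey oracle c t (passOutput getKey oracle (2 * t))
        (passCost getKey oracle (2 * t))
  | again (t : ℕ) (out : Fin m → Option K) (T : ℕ)
      (h : ¬ Enough c (passOutput getKey oracle (2 * t)))
      (next : MultiKeyLoop getKey oracle c (2 * t) out T) :
      MultiKeyLoop getKey oracle c t out (passCost getKey oracle (2 * t) + T)

/-- MultiKeyGuess (the loop started with `t = 1`) terminates with output `out` after `T` trials
in total. -/
def MultiKeyGuess {K : Type*} {m : ℕ} (getKey : ℕ → K) (oracle : Fin m → K → Bool) (c : ℝ)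
    (out : Fin m → Option K) (T : ℕ) : Prop :=
  MultiKeyLoop getKey oracle c 1 out T

/-- The algorithm is deterministic: output and cost are determined by the input. -/
theorem MultiKeyLoop.deterministic {K : Type*} {m : ℕ} {getKey : ℕ → K}
    {oracle : Fin m → K → Bool} {c : ℝ} {t : ℕ} {out out' : Fin m → Option K} {T T' : ℕ}
    (h : MultiKeyLoop getKey oracle c t out T) (h' : MultiKeyLoop getKey oracle c t out' T') :
    out = out' ∧ T = T' := by
  induction h generalizing out' T' with
  | finish t h =>
    cases h' with
    | finish _ _ => exact ⟨rfl, rfl⟩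
    | again _ _ _ hn _ => exact absurd h hn
  | again t out T h next ih =>
    cases h' with
    | finish _ hs => exact absurd hs h
    | again _ _ T₂ _ next' =>
      obtain ⟨h1, h2⟩ := ih next'
      exact ⟨h1, by rw [h2]⟩

/-- `out` solves the multi-key guessing problem with parameter `c` for the keys `keys`: at least
`c m` of the keys are recovered. -/
def IsSolution {K : Type*} {m : ℕ} (c : ℝ) (keys : Fin m → K) (out : Fin m → Option K) : Prop :=
  c * m ≤ ({j | out j = some (keys j)} : Set (Fin m)).ncard

/-- On the keys `keys`, MultiKeyGuess terminates, solves the multi-key guessing problem, and has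
amortized cost (number of trials per key) at most `B`. -/
def SolvesAtCost {K : Type*} {m : ℕ} (getKey : ℕ → K) (c B : ℝ) (keys : Fin m → K) : Prop :=
  ∃ (out : Fin m → Option K) (T : ℕ),
    MultiKeyGuess getKey (fun j => keyOracle (keys j)) c out T ∧
      IsSolution c keys out ∧ (T : ℝ) / m ≤ B

/-- The probability, over `m` independent keys drawn from `χ^n`, of a set of key tuples. -/
def keyProb {A : Type*} (χ : PMF A) (n m : ℕ) (S : Set (Fin m → Fin n → A)) : ℝ :=
  ((iid (iid χ n) m).toOuterMeasure S).toReal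

end

end MultiKey

namespace MultiKey

/-! ### The algorithm on a fixed tuple of keys -/

/-! At most `1 / p` keys have probability at least `p`, so a key of probability at least `1 / B` has
position at most `B` in any decreasing enumeration. Hence every pass with threshold at least `B`
finds all such keys. If they make up a fraction `c` of the sample, doubling stops in time and the
geometric series of pass costs is at most `4 B` per key (`solvesAtCost_of_le_ncard`).

It remains to choose `B` so that a random key has probability at least `1 / B` with chance at least
some `q > c`. A Chernoff bound (`exists_chernoff`) then makes the failure probability exponentially
small in `m`, with a rate depending only on `c` and `q` and hence uniform in `n`.

The information content `-log₂` of the probability of a key is a sum of `n` i.i.d. bounded terms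
with mean `H(χ)`. For `c < 1/2` the central limit theorem puts it below `H(χ) n` with chance at
least `q`, where `c < q < 1/2`, once `n` is large; small `n` cost only a constant factor. For larger
`c`, Chebyshev's inequality gives any `q < 1` after adding `C √n` to the exponent
(`exists_information_bounds`). -/

theorem abortedLoop_snd_le {K : Type*} (getKey : ℕ → K) (oracle : K → Bool) (r i : ℕ) :
    (abortedLoop getKey oracle r i).2 ≤ r := by
  induction r generalizing i with
  | zero => simp [abortedLoop]
  | succ r ih =>
    rw [abortedLoop]
    split_ifs
    · simp
    · simpa using ih (i + 1)

theorem abortedLoop_fst_keyOracle {K : Type*} (getKey : ℕ → K) (k : K) (r i : ℕ) :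
    (abortedLoop getKey (keyOracle k) r i).1 = none ∨
      (abortedLoop getKey (keyOracle k) r i).1 = some k := by
  induction r generalizing i with
  | zero => simp [abortedLoop]
  | succ r ih =>
    rw [abortedLoop]
    split_ifs with h
    · right
      simpa [keyOracle] using h
    · exact ih (i + 1)

theorem abortedLoop_fst_ne_none {K : Type*} (getKey : ℕ → K) (k : K) (r i l : ℕ)
    (hil : i < l) (hl : l ≤ i + r) (hk : getKey l = k) :
    (abortedLoop getKey (keyOracle k) r i).1 ≠ none := by
  induction r generalizing i with
  | zero => omega
  | succ r ih =>
    rw [abortedLoop]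
    split_ifs with h
    · simp
    · have hne : l ≠ i + 1 := by
        rintro rfl
        exact h (by simp [keyOracle, hk])
      exact ih (i + 1) (by omega) (by omega)

theorem passCost_le {K : Type*} {m : ℕ} (getKey : ℕ → K) (oracle : Fin m → K → Bool) (t : ℕ) :
    passCost getKey oracle t ≤ t * m := by
  calc passCost getKey oracle t ≤ ∑ _j : Fin m, t :=
        Finset.sum_le_sum fun j _ => abortedLoop_snd_le _ _ _ _
    _ = t * m := by simp [mul_comm]

/-- If every pass with threshold at least `B` finds enough keys, then the loop entered with
`t ≤ B` stops after at most `(4 B - 2 t) m` trials. -/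
theorem exists_multiKeyLoop {K : Type*} {m : ℕ} (getKey : ℕ → K) (oracle : Fin m → K → Bool)
    (c B : ℝ) (hB : ∀ t : ℕ, B ≤ t → Enough c (passOutput getKey oracle t))
    (t : ℕ) (ht : 1 ≤ t) (htB : (t : ℝ) ≤ B) :
    ∃ (s T : ℕ), MultiKeyLoop getKey oracle c t (passOutput getKey oracle s) T ∧
      Enough c (passOutput getKey oracle s) ∧ (T : ℝ) ≤ (4 * B - 2 * t) * m := by
  -- `N` bounds the gap `B - t`, which drops by at least one when `t ≥ 1` doubles. The budget is
  -- self-consistent: the next pass costs at most `2 t m` and leaves `(4 B - 4 t) m`, the budget for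
  -- `2 t`.
  have key : ∀ N t : ℕ, 1 ≤ t → (t : ℝ) ≤ B → B ≤ t + N →
      ∃ (s T : ℕ), MultiKeyLoop getKey oracle c t (passOutput getKey oracle s) T ∧
        Enough c (passOutput getKey oracle s) ∧ (T : ℝ) ≤ (4 * B - 2 * t) * m := by
    intro N
    induction N with
    | zero =>
      intro t ht htB hN
      have hE : Enough c (passOutput getKey oracle (2 * t)) := by
        refine hB _ ?_
        push_cast at hN ⊢
        linarith
      refine ⟨2 * t, _, .finish t hE, hE, ?_⟩
      have h1 : (passCost getKey oracle (2 * t) : ℝ) ≤ (2 * t : ℝ) * m := by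
        exact_mod_cast passCost_le getKey oracle (2 * t)
      refine h1.trans (mul_le_mul_of_nonneg_right ?_ (Nat.cast_nonneg _))
      linarith
    | succ N ih =>
      intro t ht htB hN
      have h1 : (passCost getKey oracle (2 * t) : ℝ) ≤ (2 * t : ℝ) * m := by
        exact_mod_cast passCost_le getKey oracle (2 * t)
      by_cases hE : Enough c (passOutput getKey oracle (2 * t))
      · refine ⟨2 * t, _, .finish t hE, hE, ?_⟩
        refine h1.trans (mul_le_mul_of_nonneg_right ?_ (Nat.cast_nonneg _))
        linarith
      · have hlt : ((2 * t : ℕ) : ℝ) < B := by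
          by_contra h
          exact hE (hB _ (not_lt.1 h))
        have ht' : (1 : ℝ) ≤ t := by exact_mod_cast ht
        obtain ⟨s, T, h2, h3, h4⟩ := ih (2 * t) (by omega) hlt.le (by
          push_cast at hN ⊢
          linarith)
        refine ⟨s, _, .again t _ T hE h2, h3, ?_⟩
        push_cast at h4 ⊢
        linarith
  obtain ⟨N, hN⟩ := exists_nat_ge (B - t)
  exact key N t ht htB (by linarith)

/-- The position of a key in the enumeration is at most the inverse of its probability. -/
theorem IsGetKey.mul_apply_le_one {K : Type*} {D : PMF K} {getKey : ℕ → K}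
    (h : IsGetKey D getKey) {i : ℕ} (hi : i ∈ Set.Icc 1 D.support.ncard) :
    (i : ENNReal) * D (getKey i) ≤ 1 := by
  classical
  have hsub : ∀ j ∈ Finset.Icc 1 i, j ∈ Set.Icc 1 D.support.ncard := by
    intro j hj
    rw [Finset.mem_Icc] at hj
    exact ⟨hj.1, hj.2.trans hi.2⟩
  calc (i : ENNReal) * D (getKey i) = ∑ _j ∈ Finset.Icc 1 i, D (getKey i) := by simp
    _ ≤ ∑ j ∈ Finset.Icc 1 i, D (getKey j) :=
        Finset.sum_le_sum fun j hj =>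
          h.antitoneOn (hsub j hj) hi (Finset.mem_Icc.1 hj).2
    _ = ∑ k ∈ (Finset.Icc 1 i).image getKey, D k := by
        rw [Finset.sum_image]
        intro a ha b hb hab
        exact h.bijOn.injOn (hsub a ha) (hsub b hb) hab
    _ ≤ ∑' k, D k := ENNReal.sum_le_tsum _
    _ = 1 := D.tsum_coe

theorem IsGetKey.exists_index_le {K : Type*} {D : PMF K} {getKey : ℕ → K}
    (h : IsGetKey D getKey) {B : ℝ} {k : K} (hk : 1 ≤ B * (D k).toReal) :
    ∃ i : ℕ, 0 < i ∧ (i : ℝ) ≤ B ∧ getKey i = k := by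
  have h0 : (D k).toReal ≠ 0 := by
    intro h0
    rw [h0, mul_zero] at hk
    linarith
  have hsupp : k ∈ D.support := by
    rw [PMF.mem_support_iff]
    intro h1
    exact h0 (by simp [h1])
  obtain ⟨i, hi, rfl⟩ := h.bijOn.surjOn hsupp
  refine ⟨i, hi.1, ?_, rfl⟩
  have h1 := ENNReal.toReal_mono ENNReal.one_ne_top (h.mul_apply_le_one hi)
  simp only [ENNReal.toReal_mul, ENNReal.toReal_natCast, ENNReal.toReal_one] at h1
  have hpos : 0 < (D (getKey i)).toReal := lt_of_le_of_ne ENNReal.toReal_nonneg h0.symm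
  exact le_of_mul_le_mul_right (h1.trans hk) hpos

/-- If at least `c m` of the keys have probability at least `1 / B`, then the instance is solved
at cost at most `4 B` per key. -/
theorem solvesAtCost_of_le_ncard {K : Type*} {m : ℕ} {D : PMF K} {getKey : ℕ → K}
    (h : IsGetKey D getKey) (hm : 1 ≤ m) {c B : ℝ} (hB : 1 ≤ B) (keys : Fin m → K)
    (hkeys : c * m ≤ ({j | 1 ≤ B * (D (keys j)).toReal} : Set (Fin m)).ncard) :
    SolvesAtCost getKey c (4 * B) keys := by
  obtain ⟨s, T, h1, h2, h3⟩ := exists_multiKeyLoop getKey (fun j => keyOracle (keys j)) c B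
    (fun t ht => by
      refine hkeys.trans ?_
      rw [Nat.cast_le]
      refine Set.ncard_le_ncard (fun j hj => ?_) (Set.toFinite _)
      obtain ⟨i, hi0, hiB, hik⟩ := h.exists_index_le hj
      exact abortedLoop_fst_ne_none getKey (keys j) t 0 i hi0
        (by simpa using (Nat.cast_le (α := ℝ)).1 (hiB.trans ht)) hik)
    1 le_rfl (by simpa using hB)
  refine ⟨_, T, h1, ?_, ?_⟩
  · refine h2.trans ?_
    rw [Nat.cast_le]
    refine Set.ncard_le_ncard (fun j hj => ?_) (Set.toFinite _)
    exact (abortedLoop_fst_keyOracle getKey (keys j) s 0).resolve_left hj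
  · have hm' : (0 : ℝ) < m := by exact_mod_cast hm
    rw [div_le_iff₀ hm']
    refine h3.trans (mul_le_mul_of_nonneg_right ?_ hm'.le)
    push_cast
    linarith

theorem SolvesAtCost.mono {K : Type*} {m : ℕ} {getKey : ℕ → K} {c B B' : ℝ} {keys : Fin m → K}
    (h : SolvesAtCost getKey c B keys) (hB : B ≤ B') : SolvesAtCost getKey c B' keys := by
  obtain ⟨out, T, h1, h2, h3⟩ := h
  exact ⟨out, T, h1, h2, h3.trans hB⟩

end MultiKey
namespace MultiKey

/-! ### Concentration for product distributions -/

theorem tsum_prod_pi {A : Type*} (n : ℕ) (f : Fin n → A → ENNReal) :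
    ∑' x : Fin n → A, ∏ i, f i (x i) = ∏ i, ∑' a, f i a := by
  induction n with
  | zero => simp
  | succ n ih =>
    rw [← (Fin.consEquiv fun _ => A).tsum_eq, ENNReal.tsum_prod', Fin.prod_univ_succ, ← ih,
      ← ENNReal.tsum_mul_right]
    refine tsum_congr fun a => ?_
    rw [← ENNReal.tsum_mul_left]
    refine tsum_congr fun v => ?_
    simp [Fin.consEquiv, Fin.prod_univ_succ]

theorem toReal_toOuterMeasure_add_compl {K : Type*} (p : PMF K) (S : Set K) :
    (p.toOuterMeasure S).toReal + (p.toOuterMeasure Sᶜ).toReal = 1 := by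
  have hle : ∀ S : Set K, p.toOuterMeasure S ≠ ⊤ := fun S => by
    rw [PMF.toOuterMeasure_apply]
    exact p.tsum_coe_indicator_ne_top S
  rw [← ENNReal.toReal_add (hle _) (hle _), PMF.toOuterMeasure_apply, PMF.toOuterMeasure_apply,
    ← ENNReal.tsum_add]
  have : ∀ x, S.indicator p x + Sᶜ.indicator p x = p x :=
    fun x => congrFun (Set.indicator_self_add_compl S p) x
  simp [this]

/-- The left side is the Laplace transform at `s` of a Bernoulli variable of mean `g`; this is the
one-sample estimate behind the Chernoff bound. -/
theorem one_sub_mul_one_sub_exp_neg_le {g q s : ℝ} (hq : 0 ≤ q) (hqg : q ≤ g) (hs : 0 ≤ s) :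
    1 - g * (1 - Real.exp (-s)) ≤ Real.exp (-(q * s / (1 + s))) := by
  have h1 : Real.exp (-s) ≤ 1 / (1 + s) := by
    rw [Real.exp_neg, ← one_div]
    exact one_div_le_one_div_of_le (by linarith) (by linarith [Real.add_one_le_exp s])
  have h2 : s / (1 + s) ≤ 1 - Real.exp (-s) := by
    have : s / (1 + s) = 1 - 1 / (1 + s) := by field_simp; ring
    linarith
  have h3 : 0 ≤ s / (1 + s) := by positivity
  have h4 : q * (s / (1 + s)) ≤ g * (1 - Real.exp (-s)) :=
    mul_le_mul hqg h2 h3 (hq.trans hqg)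
  have h5 := Real.add_one_le_exp (-(q * s / (1 + s)))
  rw [mul_div_assoc] at h5 ⊢
  linarith

/-- **Chernoff bound**: if a set has probability at least `q > c`, then at least `c m` of `m`
independent samples lie in it, except with probability exponentially small in `m`. -/
theorem exists_chernoff {c q : ℝ} (hc : 0 < c) (hcq : c < q) :
    ∃ κ : ℝ, 0 < κ ∧ ∀ {K : Type*} (p : PMF K) (G : Set K) (m : ℕ),
      q ≤ (p.toOuterMeasure G).toReal →
        1 - Real.exp (-κ * m) ≤ ((iid p m).toOuterMeasure
          {x | c * m ≤ ({j | x j ∈ G} : Set (Fin m)).ncard}).toReal := by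
  classical
  -- Any `s` with `c (1 + s) < q` makes the exponent `q s / (1 + s) - s c` positive; this one puts
  -- `c (1 + s)` at the midpoint of `c` and `q`.
  obtain ⟨s, hs, hsq⟩ : ∃ s : ℝ, 0 < s ∧ c * (1 + s) < q := by
    refine ⟨(q - c) / (2 * c), by have := sub_pos.2 hcq; positivity, ?_⟩
    have : c * (1 + (q - c) / (2 * c)) = (q + c) / 2 := by field_simp; ring
    linarith
  have hκ : 0 < q * s / (1 + s) - s * c := by
    rw [sub_pos, lt_div_iff₀ (by linarith)]
    nlinarith
  refine ⟨_, hκ, ?_⟩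
  intro K p G m hG
  set S : Set (Fin m → K) := {x | c * m ≤ ({j | x j ∈ G} : Set (Fin m)).ncard} with hS
  set κ := q * s / (1 + s) - s * c with hκdef
  have hadd := toReal_toOuterMeasure_add_compl (iid p m) S
  suffices h : ((iid p m).toOuterMeasure Sᶜ).toReal ≤ Real.exp (-κ * m) by linarith
  -- Exponential tilting: the product of `f` over the samples is their probability times `exp (s (c
  -- m - #hits))`, and the last factor is at least `1` on the failure event.
  set f : K → ENNReal := fun a => p a * ENNReal.ofReal (Real.exp (s * c) *
    if a ∈ G then Real.exp (-s) else 1) with hf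
  have hpt : ∀ x, Sᶜ.indicator (iid p m) x ≤ ∏ j, f (x j) := by
    intro x
    by_cases hx : x ∈ Sᶜ
    · rw [Set.indicator_of_mem hx, iid_apply, hf, Finset.prod_mul_distrib,
        ← ENNReal.ofReal_prod_of_nonneg (fun _ _ => by split_ifs <;> positivity)]
      refine le_mul_of_one_le_right (zero_le) ?_
      rw [ENNReal.one_le_ofReal, Finset.prod_mul_distrib, Finset.prod_ite]
      have hcard : ((Finset.univ.filter fun j => x j ∈ G).card : ℝ) < c * m := by
        have : ({j | x j ∈ G} : Set (Fin m)).ncard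
            = (Finset.univ.filter fun j => x j ∈ G).card := by
          rw [← Set.ncard_coe_finset]
          simp
        rw [← this]
        simpa [hS] using hx
      simp only [Finset.prod_const, Finset.card_univ, Fintype.card_fin, one_pow, mul_one,
        ← Real.exp_nat_mul, ← Real.exp_add]
      rw [Real.one_le_exp_iff]
      nlinarith
    · rw [Set.indicator_of_notMem hx]
      exact zero_le
  have hfsum : ∑' a, f a ≤ ENNReal.ofReal (Real.exp (-κ)) := by
    have hsplit : ∀ a, f a = G.indicator p a * ENNReal.ofReal (Real.exp (s * c) * Real.exp (-s))
        + Gᶜ.indicator p a * ENNReal.ofReal (Real.exp (s * c)) := by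
      intro a
      by_cases ha : a ∈ G <;> simp [hf, ha]
    have hne : ∀ G : Set K, p.toOuterMeasure G ≠ ⊤ := fun G => by
      rw [PMF.toOuterMeasure_apply]
      exact p.tsum_coe_indicator_ne_top G
    simp_rw [hsplit]
    rw [ENNReal.tsum_add, ENNReal.tsum_mul_right, ENNReal.tsum_mul_right,
      ← PMF.toOuterMeasure_apply, ← PMF.toOuterMeasure_apply,
      ← ENNReal.ofReal_toReal (hne G), ← ENNReal.ofReal_toReal (hne Gᶜ),
      ← ENNReal.ofReal_mul ENNReal.toReal_nonneg, ← ENNReal.ofReal_mul ENNReal.toReal_nonneg,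
      ← ENNReal.ofReal_add (by positivity) (by positivity)]
    refine ENNReal.ofReal_le_ofReal ?_
    have h1 := toReal_toOuterMeasure_add_compl p G
    have h2 := one_sub_mul_one_sub_exp_neg_le (hc.trans hcq).le hG hs.le
    have h3 : Real.exp (-κ) = Real.exp (s * c) * Real.exp (-(q * s / (1 + s))) := by
      rw [← Real.exp_add, hκdef]
      congr 1
      ring
    rw [h3]
    refine le_trans (le_of_eq ?_) (mul_le_mul_of_nonneg_left h2 (Real.exp_pos _).le)
    rw [eq_sub_of_add_eq' h1]
    ring
  have hbound : (iid p m).toOuterMeasure Sᶜ ≤ ENNReal.ofReal (Real.exp (-κ * m)) := by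
    rw [PMF.toOuterMeasure_apply]
    calc _ ≤ ∑' x : Fin m → K, ∏ j, f (x j) := ENNReal.tsum_le_tsum hpt
      _ = (∑' a, f a) ^ m := by rw [tsum_prod_pi m fun _ => f]; simp
      _ ≤ ENNReal.ofReal (Real.exp (-κ)) ^ m := by gcongr
      _ = ENNReal.ofReal (Real.exp (-κ * m)) := by
        rw [← ENNReal.ofReal_pow (Real.exp_pos _).le, ← Real.exp_nat_mul, mul_comm]
  exact (ENNReal.toReal_mono ENNReal.ofReal_ne_top hbound).trans_eq
    (ENNReal.toReal_ofReal (Real.exp_pos _).le)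

end MultiKey
namespace MultiKey

/-! ### The information content of a random key -/

open MeasureTheory ProbabilityTheory Filter Topology

theorem toMeasure_iid {A : Type*} [MeasurableSpace A] (χ : PMF A) (n : ℕ) :
    (iid χ n).toMeasure = Measure.pi fun _ => χ.toMeasure := by
  refine (Measure.pi_eq fun s hs => ?_).symm
  rw [PMF.toMeasure_apply _ (MeasurableSet.univ_pi hs)]
  simp_rw [fun i => PMF.toMeasure_apply χ (hs i)]
  rw [← tsum_prod_pi n fun i => (s i).indicator χ]
  refine tsum_congr fun x => ?_
  by_cases hx : x ∈ Set.univ.pi s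
  · rw [Set.indicator_of_mem hx, iid_apply]
    exact Finset.prod_congr rfl fun i _ => (Set.indicator_of_mem (hx i trivial) _).symm
  · rw [Set.indicator_of_notMem hx]
    obtain ⟨i, hi⟩ : ∃ i, x i ∉ s i := by simpa using hx
    exact (Finset.prod_eq_zero (Finset.mem_univ i) (Set.indicator_of_notMem hi _)).symm

/-- The limit theorems need one infinite sequence of variables on a single space, whereas keys of
different lengths live on different spaces; this projection links the two. -/
theorem map_infinitePi_eq_toMeasure_iid {A : Type*} [MeasurableSpace A] (χ : PMF A) (n : ℕ) :
    (Measure.infinitePi fun _ : ℕ => χ.toMeasure).map (fun ω (i : Fin n) => ω i)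
      = (iid χ n).toMeasure := by
  rw [Measure.map_infinitePi_infinitePi_of_inj Fin.val_injective, Measure.infinitePi_eq_pi,
    toMeasure_iid]

theorem infinitePi_sum_le_eq {A : Type*} [MeasurableSpace A] (χ : PMF A) {f : A → ℝ}
    (hf : Measurable f) (n : ℕ) (r : ℝ) :
    (Measure.infinitePi fun _ : ℕ => χ.toMeasure) {ω | ∑ k ∈ Finset.range n, f (ω k) ≤ r}
      = (iid χ n).toOuterMeasure {x | ∑ i, f (x i) ≤ r} := by
  have hS : MeasurableSet {x : Fin n → A | ∑ i, f (x i) ≤ r} :=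
    measurableSet_le (by fun_prop) measurable_const
  rw [← PMF.toMeasure_apply_eq_toOuterMeasure_apply _ hS, ← map_infinitePi_eq_toMeasure_iid,
    Measure.map_apply (by fun_prop) hS]
  simp [Finset.sum_range]

/-! ### Chebyshev and central limit estimates for i.i.d. sums -/

section LimitTheorems

variable {Ω : Type*} {mΩ : MeasurableSpace Ω} {P : Measure Ω} {X : ℕ → Ω → ℝ}

theorem variance_sum_range_of_identDistrib (hX : MemLp (X 0) 2 P) (hindep : iIndepFun X P)
    (hident : ∀ i, IdentDistrib (X i) (X 0) P P) (n : ℕ) :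
    Var[∑ k ∈ Finset.range n, X k; P] = n * Var[X 0; P] := by
  rw [IndepFun.variance_sum (fun i _ => (hident i).memLp_iff.2 hX)
    fun i _ j _ hij => hindep.indepFun hij]
  simp [fun i => (hident i).variance_eq]

variable [IsProbabilityMeasure P]

theorem integral_sum_range_of_identDistrib (hX : MemLp (X 0) 2 P)
    (hident : ∀ i, IdentDistrib (X i) (X 0) P P) (n : ℕ) :
    ∫ ω, (∑ k ∈ Finset.range n, X k) ω ∂P = n * P[X 0] := by
  simp only [Finset.sum_apply]
  rw [integral_finsetSum _ fun i _ => ((hident i).memLp_iff.2 hX).integrable (by norm_num)]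
  simp [fun i => (hident i).integral_eq]

/-- A sum of `n` independent copies exceeds its mean by more than `C √n` with small probability. -/
theorem exists_forall_le_measure_sum_le (hX : MemLp (X 0) 2 P) (hindep : iIndepFun X P)
    (hident : ∀ i, IdentDistrib (X i) (X 0) P P) {q : ℝ} (hq : q < 1) :
    ∃ C : ℝ, 0 < C ∧ ∀ n : ℕ, 1 ≤ n → q ≤
      (P {ω | ∑ k ∈ Finset.range n, X k ω ≤ n * P[X 0] + C * Real.sqrt n}).toReal := by
  set v := Var[X 0; P] with hv
  have hv0 : 0 ≤ v := variance_nonneg _ _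
  have hq' : 0 < 1 - q := by linarith
  -- Chebyshev leaves failure probability `v / C²`. Here `(1 - q) C = (1 - q) + v ≥ v` and `C ≥ 1`,
  -- so this is at most `1 - q`.
  set C := 1 + v / (1 - q) with hC
  have hC1 : 1 ≤ C := by
    have : 0 ≤ v / (1 - q) := by positivity
    linarith
  refine ⟨C, by linarith, fun n hn => ?_⟩
  have hn0 : (0 : ℝ) < n := by exact_mod_cast hn
  have hsum : MemLp (∑ k ∈ Finset.range n, X k) 2 P :=
    memLp_finsetSum' _ fun i _ => (hident i).memLp_iff.2 hX
  have hcheb := meas_ge_le_variance_div_sq hsum (c := C * Real.sqrt n) (by positivity)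
  rw [variance_sum_range_of_identDistrib hX hindep hident,
    integral_sum_range_of_identDistrib hX hident] at hcheb
  have hratio : n * v / (C * Real.sqrt n) ^ 2 ≤ 1 - q := by
    rw [mul_pow, Real.sq_sqrt hn0.le, div_le_iff₀ (by positivity)]
    have h1 : (1 - q) * C = (1 - q) + v := by rw [hC]; field_simp
    nlinarith [mul_nonneg hn0.le (mul_nonneg hq'.le (by nlinarith : 0 ≤ C * (C - 1)))]
  set S := {ω | C * Real.sqrt n ≤ |(∑ k ∈ Finset.range n, X k) ω - n * P[X 0]|} with hS
  have hPS : (P S).toReal ≤ 1 - q :=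
    (ENNReal.toReal_mono ENNReal.ofReal_ne_top hcheb).trans
      ((ENNReal.toReal_ofReal (by positivity)).trans_le hratio)
  set T := {ω | ∑ k ∈ Finset.range n, X k ω ≤ n * P[X 0] + C * Real.sqrt n} with hT
  have hcover : Set.univ ⊆ S ∪ T := by
    intro ω _
    by_cases h : ω ∈ S
    · exact Or.inl h
    · right
      simp only [hS, Set.mem_ofPred_eq, not_le, Finset.sum_apply] at h
      have := (abs_lt.1 h).2
      simp only [hT, Set.mem_ofPred_eq]
      linarith
  have h1 : (1 : ENNReal) ≤ P S + P T := by
    rw [← measure_univ (μ := P)]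
    exact (measure_mono hcover).trans (measure_union_le _ _)
  have h2 := ENNReal.toReal_mono (by finiteness) h1
  rw [ENNReal.toReal_add (by finiteness) (by finiteness), ENNReal.toReal_one] at h2
  linarith

theorem half_le_gaussianReal_Iic_zero (v : NNReal) :
    (1 / 2 : ℝ) ≤ (gaussianReal 0 v (Set.Iic 0)).toReal := by
  have hsymm : gaussianReal 0 v (Set.Ici 0) = gaussianReal 0 v (Set.Iic 0) := by
    conv_lhs => rw [← neg_zero (G := ℝ), ← gaussianReal_map_neg,
      Measure.map_apply (by fun_prop) measurableSet_Ici]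
    congr 1
    ext x
    simp
  have h1 : (1 : ENNReal) ≤ gaussianReal 0 v (Set.Iic 0) + gaussianReal 0 v (Set.Iic 0) := by
    nth_rewrite 2 [← hsymm]
    rw [← measure_univ (μ := gaussianReal 0 v), ← Set.Iic_union_Ici (a := (0 : ℝ))]
    exact measure_union_le _ _
  have h2 := ENNReal.toReal_mono (by finiteness) h1
  rw [ENNReal.toReal_add (by finiteness) (by finiteness), ENNReal.toReal_one] at h2
  linarith

/-- A sum of many independent copies is at most its mean with probability almost `1 / 2`. -/
theorem eventually_le_measure_sum_le_mean (hX : MemLp (X 0) 2 P) (hindep : iIndepFun X P)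
    (hident : ∀ i, IdentDistrib (X i) (X 0) P P) {q : ℝ} (hq : q < 1 / 2) :
    ∀ᶠ n : ℕ in atTop, q ≤ (P {ω | ∑ k ∈ Finset.range n, X k ω ≤ n * P[X 0]}).toReal := by
  -- With zero variance the limit is a point mass at `0`, the boundary of the half-line, so weak
  -- convergence says nothing there; but then the sum equals its mean almost surely.
  by_cases hv : Var[X 0; P] = 0
  · refine Eventually.of_forall fun n => ?_
    have hsum : MemLp (∑ k ∈ Finset.range n, X k) 2 P :=
      memLp_finsetSum' _ fun i _ => (hident i).memLp_iff.2 hX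
    have hae := ae_eq_integral_of_variance_eq_zero hsum (by
      rw [variance_sum_range_of_identDistrib hX hindep hident, hv, mul_zero])
    rw [integral_sum_range_of_identDistrib hX hident] at hae
    have h1 : P {ω | ∑ k ∈ Finset.range n, X k ω ≤ n * P[X 0]} = 1 := by
      rw [← measure_univ (μ := P)]
      refine measure_congr (eventuallyEq_univ.2 ?_)
      filter_upwards [hae] with ω hω
      rw [Finset.sum_apply] at hω
      exact hω.le
    rw [h1, ENNReal.toReal_one]
    linarith
  · set v := Var[X 0; P].toNNReal with hvdef
    have hv' : v ≠ 0 := by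
      rw [hvdef, ne_eq, Real.toNNReal_eq_zero, not_le]
      exact lt_of_le_of_ne (variance_nonneg _ _) (Ne.symm hv)
    have hY : HasLaw id (gaussianReal 0 v) (gaussianReal 0 v) := HasLaw.id
    have hclt := tendstoInDistribution_inv_sqrt_mul_sum_sub hY hX hindep hident
    have := nullSingletonClass_gaussianReal (μ := 0) hv'
    have hlim := ProbabilityMeasure.tendsto_measure_of_null_frontier_of_tendsto' hclt.tendsto
      (E := Set.Iic 0) (by simp)
    simp only [ProbabilityMeasure.coe_mk, Measure.map_id] at hlim
    have hlim' := (ENNReal.tendsto_toReal (measure_ne_top _ _)).comp hlim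
    have hlt := hq.trans_le (half_le_gaussianReal_Iic_zero v)
    filter_upwards [hlim'.eventually_const_lt hlt, eventually_ge_atTop 1] with n hn hn1
    refine hn.le.trans (le_of_eq ?_)
    simp only [Function.comp_apply]
    rw [Measure.map_apply_of_aemeasurable (hclt.forall_aemeasurable n) measurableSet_Iic]
    congr 2
    ext ω
    have hs : (0 : ℝ) < (Real.sqrt n)⁻¹ := by
      have : (0 : ℝ) < n := by exact_mod_cast hn1
      positivity
    simp only [Set.mem_preimage, Set.mem_Iic, Set.mem_ofPred_eq]
    rw [← not_lt, mul_pos_iff_of_pos_left hs, not_lt, sub_nonpos]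

end LimitTheorems

/-! ### Information content and entropy -/

section Information

variable {A : Type*}

theorem toReal_iid_apply (χ : PMF A) (n : ℕ) (x : Fin n → A) :
    (iid χ n x).toReal = ∏ i, (χ (x i)).toReal := by
  rw [iid_apply, ENNReal.toReal_prod]

/-- The support hypothesis matters: since `Real.logb 2 0 = 0`, an impossible letter would count as
carrying no information. -/
theorem one_le_rpow_mul_iid_apply (χ : PMF A) {n : ℕ} {r : ℝ} {x : Fin n → A}
    (hx : x ∈ (iid χ n).support) (hr : ∑ i, -Real.logb 2 (χ (x i)).toReal ≤ r) :
    1 ≤ (2 : ℝ) ^ r * (iid χ n x).toReal := by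
  have hpos : 0 < (iid χ n x).toReal :=
    ENNReal.toReal_pos ((PMF.mem_support_iff _ _).1 hx) (PMF.apply_ne_top _ _)
  have hne : ∀ i ∈ Finset.univ, (χ (x i)).toReal ≠ 0 := by
    rw [← Finset.prod_ne_zero_iff, ← toReal_iid_apply]
    exact hpos.ne'
  rw [Finset.sum_neg_distrib, ← Real.logb_prod _ _ hne, ← toReal_iid_apply] at hr
  rw [← Real.rpow_logb (b := 2) (by norm_num) (by norm_num) hpos,
    ← Real.rpow_add (by norm_num)]
  refine Real.one_le_rpow (by norm_num) ?_
  linarith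

theorem toReal_toOuterMeasure_mono {K : Type*} (p : PMF K) {S T : Set K}
    (h : S ∩ p.support ⊆ T) : (p.toOuterMeasure S).toReal ≤ (p.toOuterMeasure T).toReal := by
  refine ENNReal.toReal_mono ?_ (p.toOuterMeasure_mono h)
  rw [PMF.toOuterMeasure_apply]
  exact p.tsum_coe_indicator_ne_top T

theorem exists_abs_logb_le {χ : PMF A} (hχ : χ.support.Finite) :
    ∃ M : ℝ, ∀ a, ‖-Real.logb 2 (χ a).toReal‖ ≤ M := by
  obtain ⟨M, hM⟩ := (hχ.image fun a => ‖-Real.logb 2 (χ a).toReal‖).bddAbove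
  refine ⟨max M 0, fun a => ?_⟩
  by_cases ha : a ∈ χ.support
  · exact (hM ⟨a, ha, rfl⟩).trans (le_max_left _ _)
  · rw [(PMF.apply_eq_zero_iff _ _).2 ha]
    simp

theorem shannonEntropy_nonneg (χ : PMF A) : 0 ≤ shannonEntropy χ := by
  rw [shannonEntropy, neg_nonneg]
  refine tsum_nonpos fun a => mul_nonpos_of_nonneg_of_nonpos ENNReal.toReal_nonneg ?_
  exact Real.logb_nonpos (by norm_num) ENNReal.toReal_nonneg
    (ENNReal.toReal_le_of_le_ofReal (by norm_num) (by simpa using χ.coe_le_one a))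

theorem integral_neg_logb_eq_shannonEntropy [MeasurableSpace A] [DiscreteMeasurableSpace A]
    {χ : PMF A} (hχ : χ.support.Finite) :
    ∫ a, -Real.logb 2 (χ a).toReal ∂χ.toMeasure = shannonEntropy χ := by
  obtain ⟨M, hM⟩ := exists_abs_logb_le hχ
  rw [PMF.integral_eq_tsum _ _
    (Integrable.of_bound (Measurable.of_discrete.aestronglyMeasurable) M (ae_of_all _ hM)),
    shannonEntropy, ← tsum_neg]
  simp

/-- Both limit theorems for the information content of `n` independent samples, expressed through
the mass function of the product distribution. -/
theorem exists_information_bounds {χ : PMF A} (hχ : χ.support.Finite) :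
    (∀ q : ℝ, q < 1 → ∃ C : ℝ, 0 < C ∧ ∀ n : ℕ, 1 ≤ n → q ≤ ((iid χ n).toOuterMeasure
      {x | 1 ≤ (2 : ℝ) ^ (shannonEntropy χ * n + C * Real.sqrt n) *
        (iid χ n x).toReal}).toReal) ∧
    (∀ q : ℝ, q < 1 / 2 → ∃ N : ℕ, ∀ n : ℕ, N ≤ n → q ≤ ((iid χ n).toOuterMeasure
      {x | 1 ≤ (2 : ℝ) ^ (shannonEntropy χ * n) * (iid χ n x).toReal}).toReal) := by
  -- The statement involves only mass functions, so the discrete σ-algebra may be chosen, making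
  -- every function measurable.
  let _ : MeasurableSpace A := ⊤
  have : DiscreteMeasurableSpace A := ⟨fun _ => trivial⟩
  set f : A → ℝ := fun a => -Real.logb 2 (χ a).toReal with hf
  have hfm : Measurable f := Measurable.of_discrete
  obtain ⟨M, hM⟩ := exists_abs_logb_le hχ
  set P := Measure.infinitePi fun _ : ℕ => χ.toMeasure with hP
  set X : ℕ → (ℕ → A) → ℝ := fun k ω => f (ω k) with hXdef
  have hXm : ∀ k, Measurable (X k) := fun k => by fun_prop
  have hX : MemLp (X 0) 2 P :=
    MemLp.of_bound (hXm 0).aestronglyMeasurable M (ae_of_all _ fun ω => hM (ω 0))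
  have hindep : iIndepFun X P := iIndepFun_infinitePi fun _ => hfm
  have hmap : ∀ k, P.map (X k) = χ.toMeasure.map f := fun k => by
    rw [← Measure.infinitePi_map_eval (fun _ : ℕ => χ.toMeasure) k,
      Measure.map_map hfm (by fun_prop)]
    rfl
  have hident : ∀ k, IdentDistrib (X k) (X 0) P P := fun k =>
    ⟨(hXm k).aemeasurable, (hXm 0).aemeasurable, by rw [hmap, hmap]⟩
  have hmean : P[X 0] = shannonEntropy χ := by
    rw [← integral_neg_logb_eq_shannonEntropy hχ,
      ← Measure.infinitePi_map_eval (fun _ : ℕ => χ.toMeasure) 0,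
      integral_map (measurable_pi_apply 0).aemeasurable hfm.aestronglyMeasurable]
  have htransfer : ∀ (n : ℕ) (r : ℝ), (P {ω | ∑ k ∈ Finset.range n, X k ω ≤ r}).toReal ≤
      ((iid χ n).toOuterMeasure {x | 1 ≤ (2 : ℝ) ^ r * (iid χ n x).toReal}).toReal := by
    intro n r
    rw [infinitePi_sum_le_eq χ hfm]
    exact toReal_toOuterMeasure_mono _ fun x hx => one_le_rpow_mul_iid_apply χ hx.2 hx.1
  constructor
  · intro q hq
    obtain ⟨C, hC, h⟩ := exists_forall_le_measure_sum_le hX hindep hident hq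
    refine ⟨C, hC, fun n hn => (h n hn).trans ?_⟩
    rw [hmean, mul_comm (n : ℝ)]
    exact htransfer n _
  · intro q hq
    obtain ⟨N, hN⟩ := eventually_atTop.1 (eventually_le_measure_sum_le_mean hX hindep hident hq)
    refine ⟨N, fun n hn => (hN n hn).trans ?_⟩
    rw [hmean, mul_comm (n : ℝ)]
    exact htransfer n _

/-- `p` is the least positive mass of a letter. The bound serves the finitely many `n` not reached
by the central limit theorem. -/
theorem exists_pow_le_iid_apply {χ : PMF A} (hχ : χ.support.Finite) :
    ∃ p : ℝ, 0 < p ∧ p ≤ 1 ∧ ∀ (n : ℕ) (x : Fin n → A), x ∈ (iid χ n).support →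
      p ^ n ≤ (iid χ n x).toReal := by
  obtain ⟨a₀, ha₀, hmin⟩ :=
    hχ.exists_minimalFor (fun a => (χ a).toReal) _ χ.support_nonempty
  have hmin' : ∀ a ∈ χ.support, (χ a₀).toReal ≤ (χ a).toReal := fun a ha =>
    (le_total _ _).elim id fun h => hmin ha h
  refine ⟨(χ a₀).toReal, ENNReal.toReal_pos ((PMF.mem_support_iff _ _).1 ha₀)
    (PMF.apply_ne_top _ _), ENNReal.toReal_le_of_le_ofReal (by norm_num)
      (by simpa using χ.coe_le_one a₀), fun n x hx => ?_⟩
  rw [PMF.mem_support_iff, iid_apply, Finset.prod_ne_zero_iff] at hx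
  rw [toReal_iid_apply]
  calc (χ a₀).toReal ^ n = ∏ _i : Fin n, (χ a₀).toReal := by simp
    _ ≤ _ := Finset.prod_le_prod (fun _ _ => ENNReal.toReal_nonneg) fun i hi =>
      hmin' _ ((PMF.mem_support_iff _ _).2 (hx i hi))

end Information

end MultiKey
-- From probable keys to the cost bounds
namespace MultiKey

/-- If the keys of probability at least `1 / B` have total probability at least `q > c`, then the
instance is solved at cost at most `4 B` per key, up to an exponentially small error. -/
theorem exists_le_keyProb_solvesAtCost {c q : ℝ} (hc : 0 < c) (hcq : c < q) :
    ∃ κ : ℝ, 0 < κ ∧ ∀ {A : Type*} (χ : PMF A) (n m : ℕ) (getKey : ℕ → (Fin n → A)) (B : ℝ),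
      1 ≤ m → IsGetKey (iid χ n) getKey → 1 ≤ B →
      q ≤ ((iid χ n).toOuterMeasure {x | 1 ≤ B * (iid χ n x).toReal}).toReal →
      ∀ B' : ℝ, 4 * B ≤ B' →
        1 - Real.exp (-κ * m) ≤ keyProb χ n m {keys | SolvesAtCost getKey c B' keys} := by
  obtain ⟨κ, hκ, h⟩ := exists_chernoff hc hcq
  refine ⟨κ, hκ, fun χ n m getKey B hm hget hB hq B' hB' => ?_⟩
  refine (h (iid χ n) _ m hq).trans (toReal_toOuterMeasure_mono _ fun keys hkeys => ?_)
  exact (solvesAtCost_of_le_ncard hget hm hB keys hkeys.1).mono hB'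

theorem exists_mul_entropy_bound {A : Type*} {χ : PMF A} (hχ : χ.support.Finite) {q : ℝ}
    (hq : q < 1 / 2) :
    ∃ C : ℝ, 1 ≤ C ∧ ∀ n : ℕ, q ≤ ((iid χ n).toOuterMeasure
      {x | 1 ≤ C * (2 : ℝ) ^ (shannonEntropy χ * n) * (iid χ n x).toReal}).toReal := by
  obtain ⟨N, hN⟩ := (exists_information_bounds hχ).2 q hq
  obtain ⟨p, hp0, hp1, hp⟩ := exists_pow_le_iid_apply hχ
  have hC : 1 ≤ (p ^ N)⁻¹ := (one_le_inv₀ (by positivity)).2 (pow_le_one₀ hp0.le hp1)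
  -- For `n ≤ N` every key in the support has probability at least `p ^ N`, so with this constant
  -- all of them qualify.
  refine ⟨(p ^ N)⁻¹, hC, fun n => ?_⟩
  rcases le_total N n with hn | hn
  · refine (hN n hn).trans (toReal_toOuterMeasure_mono _ fun x hx => ?_)
    refine Set.mem_ofPred_eq.ge (le_trans hx.1 ?_)
    rw [mul_assoc]
    exact le_mul_of_one_le_left (by positivity) hC
  · have hH : 1 ≤ (2 : ℝ) ^ (shannonEntropy χ * n) :=
      Real.one_le_rpow (by norm_num) (mul_nonneg (shannonEntropy_nonneg χ) (Nat.cast_nonneg n))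
    have hone : ((iid χ n).toOuterMeasure Set.univ).toReal = 1 := by
      rw [(PMF.toOuterMeasure_apply_eq_one_iff _ _).2 (Set.subset_univ _), ENNReal.toReal_one]
    refine le_trans (by linarith) (hone.ge.trans
      (toReal_toOuterMeasure_mono _ fun x hx => ?_))
    have h1 : p ^ N ≤ (iid χ n x).toReal :=
      (pow_le_pow_of_le_one hp0.le hp1 hn).trans (hp n x hx.2)
    calc (1 : ℝ) = (p ^ N)⁻¹ * 1 * p ^ N := by field_simp
      _ ≤ _ := by gcongr

end MultiKey

theorem mainTheorem2 {A : Type*} (χ : PMF A) (hχ : χ.support.Finite)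
    (c : ℝ) (hc0 : 0 < c) (hc1 : c < 1) :
    (c < 1 / 2 →
      ∃ (κ C : ℝ) (d : ℕ), 0 < κ ∧ 0 < C ∧
        ∀ n m : ℕ, 1 ≤ n → 1 ≤ m →
          ∀ getKey : ℕ → (Fin n → A), MultiKey.IsGetKey (MultiKey.iid χ n) getKey →
            1 - Real.exp (-κ * m) ≤
              MultiKey.keyProb χ n m
                {keys | MultiKey.SolvesAtCost getKey c
                  (C * (2 : ℝ) ^ (MultiKey.shannonEntropy χ * n) *
                    (1 + Real.logb 2 ((2 : ℝ) ^ (MultiKey.shannonEntropy χ * n))) ^ d) keys}) ∧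
    (1 / 2 ≤ c →
      ∃ κ C : ℝ, 0 < κ ∧ 0 < C ∧
        ∀ n m : ℕ, 1 ≤ n → 1 ≤ m →
          ∀ getKey : ℕ → (Fin n → A), MultiKey.IsGetKey (MultiKey.iid χ n) getKey →
            1 - Real.exp (-κ * m) ≤
              MultiKey.keyProb χ n m
                {keys | MultiKey.SolvesAtCost getKey c
                  ((2 : ℝ) ^ (MultiKey.shannonEntropy χ * n + C * Real.sqrt n)) keys}) := by
  have hH := MultiKey.shannonEntropy_nonneg χ
  constructor
  · intro hc
    obtain ⟨q, hcq, hq⟩ := exists_between hc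
    obtain ⟨κ, hκ, h⟩ := MultiKey.exists_le_keyProb_solvesAtCost hc0 hcq
    obtain ⟨C, hC, hbound⟩ := MultiKey.exists_mul_entropy_bound hχ hq
    -- No logarithmic factor is needed, so `d = 0`.
    refine ⟨κ, 4 * C, 0, hκ, by linarith, fun n m _ hm getKey hget => ?_⟩
    refine h χ n m getKey _ hm hget ?_ (hbound n) _ (le_of_eq (by ring))
    exact one_le_mul_of_one_le_of_one_le hC
      (Real.one_le_rpow (by norm_num) (mul_nonneg hH (Nat.cast_nonneg n)))
  · intro _
    obtain ⟨q, hcq, hq⟩ := exists_between hc1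
    obtain ⟨κ, hκ, h⟩ := MultiKey.exists_le_keyProb_solvesAtCost hc0 hcq
    obtain ⟨C, hC, hbound⟩ := (MultiKey.exists_information_bounds hχ).1 q hq
    -- The extra `2` absorbs the factor `4 = 2 ^ 2` of the doubling search, because `√n ≥ 1`.
    refine ⟨κ, C + 2, hκ, by linarith, fun n m hn hm getKey hget => ?_⟩
    refine h χ n m getKey _ hm hget ?_ (hbound n hn) _ ?_
    · exact Real.one_le_rpow (by norm_num) (by positivity)
    · have hs : 1 ≤ Real.sqrt n := Real.one_le_sqrt.2 (by exact_mod_cast hn)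
      rw [show (4 : ℝ) = (2 : ℝ) ^ (2 : ℝ) by norm_num, ← Real.rpow_add (by norm_num)]
      exact Real.rpow_le_rpow_of_exponent_le (by norm_num) (by linarith)
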